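/- Let $(M,g)$ be a spacetime, that is, a smooth (Hausdorff, second countable) $4$-dimensional manifold $M$ with a smooth Lorentzian metric $g$ of signature $(-,+,+,+)$ and a time orientation. Write $p\ll q$ if there is a (piecewise $C^1$) future directed timelike curve from $p$ to $q$, and $p\le q$ if $p=q$ or there is a (piecewise $C^1$) future directed causal curve from $p$ to $q$. For $S\subset M$ put $I^{+}(S)=\{q:\ p\ll q \text{ for some } p\in S\}$, $I^{-}(S)=\{p:\ p\ll q\text{ for some } q\in S\}$ and $J^{-}(S)=\{p:\ p\le q\text{ for some } q\in S\}$. Let $r\in M$ satisfy $r\ll r$, let $[r]=\{q\in M:\ r\ll q\ll r\}$ be its chronology violating class, let $\dot{[r]}$ be the topological boundary and $\overline{[r]}$ the closure of $[r]$ in $M$, and let $B_f([r])=\overline{[r]}\setminus I^{-}([r])$ be the future boundary of $[r]$. If $I^{+}([r])=M$, then $$\dot{[r]}=B_f([r]),\qquad J^{-}\big(\overline{[r]}\big)=\overline{[r]},\qquad I^{-}\big(\overline{[r]}\big)=[r].$$ -/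

import Mathlib

open Set
open scoped Manifold ContDiff Topology

namespace Spacetime

section

variable {M : Type*} [TopologicalSpace M] [ChartedSpace (EuclideanSpace ℝ (Fin 4)) M]
  [IsManifold (𝓡 4) ∞ M]

variable (M) in
/-- A smooth Lorentzian metric of signature `(-,+,+,+)` on a 4-manifold: a smooth section of the
bundle of bilinear forms on the tangent spaces, symmetric at each point and admitting at each
point an orthonormal basis with respect to which its matrix is `diag(-1, 1, 1, 1)`. -/
structure LorentzianMetric where
  inner (x : M) : TangentSpace (𝓡 4) x →L[ℝ] TangentSpace (𝓡 4) x →L[ℝ] ℝ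
  symm (x : M) (v w : TangentSpace (𝓡 4) x) : inner x v w = inner x w v
  signature (x : M) : ∃ b : Module.Basis (Fin 4) ℝ (TangentSpace (𝓡 4) x),
    ∀ i j, inner x (b i) (b j) = Matrix.diagonal ![-1, 1, 1, 1] i j
  contMDiff : ContMDiff (𝓡 4)
    ((𝓡 4).prod 𝓘(ℝ, EuclideanSpace ℝ (Fin 4) →L[ℝ] EuclideanSpace ℝ (Fin 4) →L[ℝ] ℝ)) ∞
    (fun x ↦ Bundle.TotalSpace.mk'
      (EuclideanSpace ℝ (Fin 4) →L[ℝ] EuclideanSpace ℝ (Fin 4) →L[ℝ] ℝ) x (inner x))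

/-- A time orientation, given by a continuous vector field which is everywhere timelike. -/
structure TimeOrientation (g : LorentzianMetric M) where
  field (x : M) : TangentSpace (𝓡 4) x
  continuous : Continuous (fun x ↦ (⟨x, field x⟩ : TangentBundle (𝓡 4) M))
  timelike (x : M) : g.inner x (field x) (field x) < 0

variable {g : LorentzianMetric M} (τ : TimeOrientation g)

/-- `v` is a future directed timelike vector: timelike, and in the same half of the cone as the
time orientation. -/
def IsFutureTimelike {x : M} (v : TangentSpace (𝓡 4) x) : Prop :=
  g.inner x v v < 0 ∧ g.inner x (τ.field x) v < 0

/-- `v` is a future directed causal (timelike or lightlike) vector. -/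
def IsFutureCausal {x : M} (v : TangentSpace (𝓡 4) x) : Prop :=
  v ≠ 0 ∧ g.inner x v v ≤ 0 ∧ g.inner x (τ.field x) v < 0

/-- There is a `C^1` future directed timelike curve `[0, 1] → M` from `p` to `q`. -/
def TimelikeSegment (p q : M) : Prop :=
  ∃ γ : ℝ → M, ContMDiffOn 𝓘(ℝ, ℝ) (𝓡 4) 1 γ (Icc 0 1) ∧ γ 0 = p ∧ γ 1 = q ∧
    ∀ t ∈ Icc (0 : ℝ) 1,
      IsFutureTimelike τ (mfderivWithin 𝓘(ℝ, ℝ) (𝓡 4) γ (Icc 0 1) t (1 : ℝ))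

/-- There is a `C^1` future directed causal curve `[0, 1] → M` from `p` to `q`. -/
def CausalSegment (p q : M) : Prop :=
  ∃ γ : ℝ → M, ContMDiffOn 𝓘(ℝ, ℝ) (𝓡 4) 1 γ (Icc 0 1) ∧ γ 0 = p ∧ γ 1 = q ∧
    ∀ t ∈ Icc (0 : ℝ) 1,
      IsFutureCausal τ (mfderivWithin 𝓘(ℝ, ℝ) (𝓡 4) γ (Icc 0 1) t (1 : ℝ))

/-- The chronology relation `p ≪ q`: there is a piecewise `C^1` future directed timelike curve
from `p` to `q`, that is, a concatenation of `n ≥ 1` segments of class `C^1`. -/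
def Chron (p q : M) : Prop := Relation.TransGen (TimelikeSegment τ) p q

/-- The causal relation `p ≤ q`: either `p = q`, or there is a piecewise `C^1` future directed
causal curve from `p` to `q`, that is, a concatenation of `n ≥ 1` segments of class `C^1`. -/
def Caus (p q : M) : Prop := Relation.ReflTransGen (CausalSegment τ) p q

/-- The chronological future `I⁺(S)`. -/
def chronFuture (S : Set M) : Set M := {q | ∃ p ∈ S, Chron τ p q}

/-- The chronological past `I⁻(S)`. -/
def chronPast (S : Set M) : Set M := {p | ∃ q ∈ S, Chron τ p q}

/-- The causal past `J⁻(S)`. -/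
def causalPast (S : Set M) : Set M := {p | ∃ q ∈ S, Caus τ p q}

/-- The chronology violating set: all `p` with `p ≪ p`. -/
def chronologyViolatingSet : Set M := {p | Chron τ p p}

/-- The class `[r]` of the relation `p ≪ q ≪ p`; this is an equivalence relation on the chronology
violating set, and `[r]` is a chronology violating class when `r` belongs to that set. -/
def chronologyClass (r : M) : Set M := {q | Chron τ r q ∧ Chron τ q r}

/-- The future boundary `B_f(S)`, the closure of `S` minus `I⁻(S)`. -/
def futureBoundary (S : Set M) : Set M := closure S \ chronPast τ S

end

end Spacetime

/-!
Since `I⁺([r]) = M`, every point lies to the chronological future of `r`, so `[r]` is `I⁻(r)` and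
equals its own chronological past. The three claims then follow from two local facts of Lorentzian
geometry.

* `I⁺(p)` and `I⁻(p)` are open (`isOpen_setOf_chron_right`, `isOpen_setOf_chron_left`): near an end
  point of a timelike curve, add to its coordinate expression a small vector multiplied by a linear
  cutoff. By compactness the curve stays timelike (`eventually_timelikeSegment`). Openness of
  `I⁻(r)` gives `frontier [r] = B_f([r])`, and openness of `I⁺(p)` gives `I⁻(closure [r]) = [r]`.
* If `I⁻(closure A) ⊆ A`, then `closure A` contains the causal past of each of its points
  (`mem_closure_of_causalSegment`). No exponential map is used. In a chart around a point `γ t₀` of a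
  causal curve, the curves `t ↦ γ t - ε (t₀ - t) T`, with `T` the time orientation at `γ t₀`, are
  timelike on an interval ending at `t₀` that is independent of `ε`: the term `ε T` makes
  `g(γ', γ')` smaller by an amount of order `ε`, while, the metric being locally Lipschitz, moving the
  base point changes it by an amount of order `ε (t₀ - t)` only (`eventually_coordTimelike_tilt`).
  They all end at `γ t₀` and converge to `γ` as `ε → 0`, so `γ t` is a limit of points of
  `I⁻(γ t₀)`. Induction along the curve from its end to its beginning concludes.
-/

namespace Spacetime

open Filter

/-! ### The metric in coordinates -/

section Coordinates

variable {M : Type*} [TopologicalSpace M] [ChartedSpace (EuclideanSpace ℝ (Fin 4)) M]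
  [IsManifold (𝓡 4) ∞ M]

/-- The metric at `x`, read in the coordinates of the preferred chart at `x₀` as a bilinear form on
the model space. -/
noncomputable def coordMetric (g : LorentzianMetric M) (x₀ x : M) :
    EuclideanSpace ℝ (Fin 4) →L[ℝ] EuclideanSpace ℝ (Fin 4) →L[ℝ] ℝ :=
  (ContinuousLinearMap.precomp ℝ
    ((trivializationAt (EuclideanSpace ℝ (Fin 4)) (TangentSpace (𝓡 4)) x₀).symmL ℝ x)) ∘L
    (g.inner x) ∘L ((trivializationAt (EuclideanSpace ℝ (Fin 4)) (TangentSpace (𝓡 4)) x₀).symmL ℝ x)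

/-- The time orientation at `x`, read in the coordinates of the preferred chart at `x₀`. -/
noncomputable def coordField {g : LorentzianMetric M} (τ : TimeOrientation g) (x₀ x : M) :
    EuclideanSpace ℝ (Fin 4) :=
  (trivializationAt (EuclideanSpace ℝ (Fin 4)) (TangentSpace (𝓡 4)) x₀ ⟨x, τ.field x⟩).2

variable {g : LorentzianMetric M} (τ : TimeOrientation g)

lemma coordMetric_symm (g : LorentzianMetric M) (x₀ x : M) (v w : EuclideanSpace ℝ (Fin 4)) :
    coordMetric g x₀ x v w = coordMetric g x₀ x w v :=
  g.symm x _ _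

lemma symmL_coordField {x₀ x : M} (hx : x ∈ (extChartAt (𝓡 4) x₀).source) :
    (trivializationAt (EuclideanSpace ℝ (Fin 4)) (TangentSpace (𝓡 4)) x₀).symmL ℝ x
      (coordField τ x₀ x) = τ.field x := by
  rw [extChartAt_source] at hx
  exact (Bundle.Trivialization.symmL_apply _ hx _).trans <| Bundle.Trivialization.symm_proj_apply
    (trivializationAt (EuclideanSpace ℝ (Fin 4)) (TangentSpace (𝓡 4)) x₀) ⟨x, τ.field x⟩
    (by simpa using hx)

lemma contMDiffOn_coordMetric_apply (g : LorentzianMetric M) (x₀ : M)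
    (v w : EuclideanSpace ℝ (Fin 4)) :
    ContMDiffOn (𝓡 4) 𝓘(ℝ, ℝ) 1 (fun x ↦ coordMetric g x₀ x v w)
      (extChartAt (𝓡 4) x₀).source := by
  set e := trivializationAt (EuclideanSpace ℝ (Fin 4)) (TangentSpace (𝓡 4) : M → Type _) x₀ with he
  have hbase : (extChartAt (𝓡 4) x₀).source = e.baseSet := by
    rw [extChartAt_source]; rfl
  rw [hbase]
  -- The coordinate vector fields of the chart are smooth.
  have hv : ∀ v : EuclideanSpace ℝ (Fin 4), ContMDiffOn (𝓡 4)
      ((𝓡 4).prod 𝓘(ℝ, EuclideanSpace ℝ (Fin 4))) 1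
      (fun x ↦ Bundle.TotalSpace.mk' (EuclideanSpace ℝ (Fin 4))
        (E := (TangentSpace (𝓡 4) : M → Type _)) x (e.symmL ℝ x v)) e.baseSet := by
    intro v
    rw [e.contMDiffOn_section_baseSet_iff]
    refine (contMDiffOn_const (c := v)).congr fun x hx ↦ ?_
    have := e.apply_mk_symm hx v
    rw [e.symmL_apply hx, this]
  intro x hx
  have key : ContMDiffWithinAt (𝓡 4) ((𝓡 4).prod 𝓘(ℝ, ℝ)) 1
      (fun x ↦ Bundle.TotalSpace.mk' ℝ (E := Bundle.Trivial M ℝ) x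
        (g.inner x (e.symmL ℝ x v) (e.symmL ℝ x w))) e.baseSet x := by
    apply ContMDiffWithinAt.clm_bundle_apply₂ (F₁ := EuclideanSpace ℝ (Fin 4))
      (F₂ := EuclideanSpace ℝ (Fin 4))
    · exact (g.contMDiff.of_le (by norm_cast)).contMDiffAt.contMDiffWithinAt
    · exact hv v x hx
    · exact hv w x hx
  rw [Bundle.contMDiffWithinAt_totalSpace] at key
  exact key.2

lemma contDiffOn_coordMetric (g : LorentzianMetric M) (x₀ : M) :
    ContDiffOn ℝ 1 (fun y ↦ coordMetric g x₀ ((extChartAt (𝓡 4) x₀).symm y))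
      (extChartAt (𝓡 4) x₀).target := by
  rw [contDiffOn_clm_apply]
  intro v
  rw [contDiffOn_clm_apply]
  intro w
  rw [← contMDiffOn_iff_contDiffOn]
  exact (contMDiffOn_coordMetric_apply g x₀ v w).comp (contMDiffOn_extChartAt_symm x₀)
    (extChartAt (𝓡 4) x₀).mapsTo_symm

lemma continuousOn_coordField (x₀ : M) :
    ContinuousOn (fun y ↦ coordField τ x₀ ((extChartAt (𝓡 4) x₀).symm y))
      (extChartAt (𝓡 4) x₀).target := by
  set e := trivializationAt (EuclideanSpace ℝ (Fin 4)) (TangentSpace (𝓡 4) : M → Type _) x₀ with he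
  have h : ContinuousOn (fun x ↦ coordField τ x₀ x) (extChartAt (𝓡 4) x₀).source := by
    refine continuous_snd.comp_continuousOn
      (e.continuousOn.comp τ.continuous.continuousOn fun x hx ↦ ?_)
    rw [extChartAt_source] at hx
    rw [e.mem_source]
    exact hx
  exact h.comp (continuousOn_extChartAt_symm x₀) (extChartAt (𝓡 4) x₀).mapsTo_symm

/-- In the coordinates of a chart, the velocity of a curve is the derivative of its coordinate
expression. -/
lemma mfderivWithin_eq_symmL {γ : ℝ → M} {c : ℝ → EuclideanSpace ℝ (Fin 4)} {s : Set ℝ} {t : ℝ}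
    {v : EuclideanSpace ℝ (Fin 4)} {x₀ : M}
    (hs : UniqueDiffWithinAt ℝ s t) (hγ : MDifferentiableWithinAt 𝓘(ℝ, ℝ) (𝓡 4) γ s t)
    (hx : γ t ∈ (extChartAt (𝓡 4) x₀).source) (ht : t ∈ s)
    (hc : HasDerivWithinAt c v s t)
    (hγc : EqOn (fun u ↦ extChartAt (𝓡 4) x₀ (γ u)) c s) :
    mfderivWithin 𝓘(ℝ, ℝ) (𝓡 4) γ s t (1 : ℝ) =
      (trivializationAt (EuclideanSpace ℝ (Fin 4)) (TangentSpace (𝓡 4)) x₀).symmL ℝ (γ t) v := by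
  have hx' : γ t ∈ (chartAt (EuclideanSpace ℝ (Fin 4)) x₀).source := by
    rwa [extChartAt_source] at hx
  have h1 : mfderivWithin 𝓘(ℝ, ℝ) 𝓘(ℝ, EuclideanSpace ℝ (Fin 4))
      (extChartAt (𝓡 4) x₀ ∘ γ) s t = (mfderiv (𝓡 4) 𝓘(ℝ, EuclideanSpace ℝ (Fin 4))
        (extChartAt (𝓡 4) x₀) (γ t)).comp (mfderivWithin 𝓘(ℝ, ℝ) (𝓡 4) γ s t) :=
    mfderiv_comp_mfderivWithin t (mdifferentiableAt_extChartAt hx') hγ hs.uniqueMDiffWithinAt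
  have h2 : HasDerivWithinAt (extChartAt (𝓡 4) x₀ ∘ γ) v s t :=
    hc.congr (fun u hu ↦ hγc hu) (hγc ht)
  have h3 : mfderivWithin 𝓘(ℝ, ℝ) 𝓘(ℝ, EuclideanSpace ℝ (Fin 4))
      (extChartAt (𝓡 4) x₀ ∘ γ) s t (1 : ℝ) = v := by
    rw [mfderivWithin_eq_fderivWithin]
    exact h2.derivWithin hs
  rw [h1, ← TangentBundle.continuousLinearMapAt_trivializationAt hx'] at h3
  rw [← h3]
  exact (Bundle.Trivialization.symmL_continuousLinearMapAt _ (by simpa using hx') _).symm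

end Coordinates

/-! ### Timelike curves in a chart -/

section ChartCurves

variable {M : Type*} [TopologicalSpace M] [ChartedSpace (EuclideanSpace ℝ (Fin 4)) M]
  [IsManifold (𝓡 4) ∞ M]
variable {g : LorentzianMetric M} (τ : TimeOrientation g)

/-- `v` is a future directed timelike vector at the point with coordinates `y` in the preferred
chart at `x₀`. -/
def CoordTimelike (x₀ : M) (y v : EuclideanSpace ℝ (Fin 4)) : Prop :=
  coordMetric g x₀ ((extChartAt (𝓡 4) x₀).symm y) v v < 0 ∧
    coordMetric g x₀ ((extChartAt (𝓡 4) x₀).symm y)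
      (coordField τ x₀ ((extChartAt (𝓡 4) x₀).symm y)) v < 0

lemma isOpen_coordTimelike (x₀ : M) :
    IsOpen {p : EuclideanSpace ℝ (Fin 4) × EuclideanSpace ℝ (Fin 4) |
      p.1 ∈ (extChartAt (𝓡 4) x₀).target ∧ CoordTimelike τ x₀ p.1 p.2} := by
  rw [isOpen_iff_mem_nhds]
  rintro ⟨y, v⟩ ⟨hy, h1, h2⟩
  have hU := (isOpen_extChartAt_target (I := 𝓡 4) x₀).mem_nhds hy
  have hG : ContinuousAt (fun p : EuclideanSpace ℝ (Fin 4) × EuclideanSpace ℝ (Fin 4) ↦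
      coordMetric g x₀ ((extChartAt (𝓡 4) x₀).symm p.1)) (y, v) :=
    ContinuousAt.comp (f := Prod.fst) ((contDiffOn_coordMetric g x₀).continuousOn.continuousAt hU)
      continuousAt_fst
  have hT : ContinuousAt (fun p : EuclideanSpace ℝ (Fin 4) × EuclideanSpace ℝ (Fin 4) ↦
      coordField τ x₀ ((extChartAt (𝓡 4) x₀).symm p.1)) (y, v) :=
    ContinuousAt.comp (f := Prod.fst) ((continuousOn_coordField τ x₀).continuousAt hU)
      continuousAt_fst
  have h3 := ((hG.clm_apply continuousAt_snd).clm_apply continuousAt_snd).eventually_lt_const h1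
  have h4 := ((hG.clm_apply hT).clm_apply continuousAt_snd).eventually_lt_const h2
  filter_upwards [continuousAt_fst.eventually_mem hU, h3, h4] with p hp hp1 hp2
  exact ⟨hp, hp1, hp2⟩

/-- If `c'` is timelike along `c` over a compact interval, then `c' + f' • w` is timelike along
`c + f • w` for all sufficiently small vectors `w`. -/
lemma eventually_coordTimelike_add_smul {x₀ : M} {a b : ℝ} {c c' : ℝ → EuclideanSpace ℝ (Fin 4)}
    {f f' : ℝ → ℝ} (hc : ContinuousOn c (Icc a b)) (hc' : ContinuousOn c' (Icc a b))
    (hf : Continuous f) (hf' : Continuous f')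
    (hU : ∀ t ∈ Icc a b, c t ∈ (extChartAt (𝓡 4) x₀).target)
    (h : ∀ t ∈ Icc a b, CoordTimelike τ x₀ (c t) (c' t)) :
    ∀ᶠ w in 𝓝 (0 : EuclideanSpace ℝ (Fin 4)), ∀ t ∈ Icc a b,
      c t + f t • w ∈ (extChartAt (𝓡 4) x₀).target ∧
        CoordTimelike τ x₀ (c t + f t • w) (c' t + f' t • w) := by
  have hc1 : Continuous fun t : Icc a b ↦ c t := continuousOn_iff_continuous_domRestrict.1 hc
  have hc2 : Continuous fun t : Icc a b ↦ c' t := continuousOn_iff_continuous_domRestrict.1 hc'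
  have hF : Continuous fun p : EuclideanSpace ℝ (Fin 4) × Icc a b ↦
      (c p.2 + f p.2 • p.1, c' p.2 + f' p.2 • p.1) :=
    ((hc1.comp continuous_snd).add (by fun_prop)).prodMk
      ((hc2.comp continuous_snd).add (by fun_prop))
  have hO := (isOpen_coordTimelike τ x₀).preimage hF
  have key := isCompact_univ.eventually_forall_of_forall_eventually
    (x₀ := (0 : EuclideanSpace ℝ (Fin 4))) (K := (univ : Set (Icc a b)))
    (P := fun w t ↦ c t + f t • w ∈ (extChartAt (𝓡 4) x₀).target ∧
        CoordTimelike τ x₀ (c t + f t • w) (c' t + f' t • w))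
    (fun t _ ↦ hO.mem_nhds
      (by simpa only [mem_preimage, mem_ofPred_eq, smul_zero, add_zero] using ⟨hU t t.2, h t t.2⟩))
  filter_upwards [key] with w hw t ht using hw ⟨t, ht⟩ trivial

/-- The velocity of a curve is future directed timelike exactly when the derivative of its
coordinate expression is. -/
lemma isFutureTimelike_mfderivWithin_iff {γ : ℝ → M} {c : ℝ → EuclideanSpace ℝ (Fin 4)}
    {s : Set ℝ} {t : ℝ} {v : EuclideanSpace ℝ (Fin 4)} {x₀ : M}
    (hs : UniqueDiffWithinAt ℝ s t) (hγ : MDifferentiableWithinAt 𝓘(ℝ, ℝ) (𝓡 4) γ s t)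
    (hx : γ t ∈ (extChartAt (𝓡 4) x₀).source) (ht : t ∈ s) (hc : HasDerivWithinAt c v s t)
    (hγc : EqOn (fun u ↦ extChartAt (𝓡 4) x₀ (γ u)) c s) :
    IsFutureTimelike τ (mfderivWithin 𝓘(ℝ, ℝ) (𝓡 4) γ s t (1 : ℝ)) ↔
      CoordTimelike τ x₀ (c t) v := by
  have h1 : (extChartAt (𝓡 4) x₀).symm (c t) = γ t := by
    rw [← hγc ht]; exact (extChartAt (𝓡 4) x₀).left_inv hx
  rw [mfderivWithin_eq_symmL hs hγ hx ht hc hγc, CoordTimelike, h1, IsFutureTimelike,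
    ← symmL_coordField τ hx]
  rfl

lemma IsFutureCausal.coord {γ : ℝ → M} {c : ℝ → EuclideanSpace ℝ (Fin 4)}
    {s : Set ℝ} {t : ℝ} {v : EuclideanSpace ℝ (Fin 4)} {x₀ : M}
    (hs : UniqueDiffWithinAt ℝ s t) (hγ : MDifferentiableWithinAt 𝓘(ℝ, ℝ) (𝓡 4) γ s t)
    (hx : γ t ∈ (extChartAt (𝓡 4) x₀).source) (ht : t ∈ s) (hc : HasDerivWithinAt c v s t)
    (hγc : EqOn (fun u ↦ extChartAt (𝓡 4) x₀ (γ u)) c s)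
    (h : IsFutureCausal τ (mfderivWithin 𝓘(ℝ, ℝ) (𝓡 4) γ s t (1 : ℝ))) :
    coordMetric g x₀ ((extChartAt (𝓡 4) x₀).symm (c t)) v v ≤ 0 ∧
      coordMetric g x₀ ((extChartAt (𝓡 4) x₀).symm (c t))
        (coordField τ x₀ ((extChartAt (𝓡 4) x₀).symm (c t))) v < 0 := by
  have h1 : (extChartAt (𝓡 4) x₀).symm (c t) = γ t := by
    rw [← hγc ht]; exact (extChartAt (𝓡 4) x₀).left_inv hx
  rw [mfderivWithin_eq_symmL hs hγ hx ht hc hγc, IsFutureCausal, ← symmL_coordField τ hx] at h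
  rw [h1]
  exact h.2

lemma timelikeSegment_of_coordTimelike_unitInterval {x₀ : M} {c c' : ℝ → EuclideanSpace ℝ (Fin 4)}
    (hc : ∀ t ∈ Icc (0 : ℝ) 1, HasDerivWithinAt c (c' t) (Icc 0 1) t)
    (hc' : ContinuousOn c' (Icc 0 1))
    (hU : ∀ t ∈ Icc (0 : ℝ) 1, c t ∈ (extChartAt (𝓡 4) x₀).target)
    (h : ∀ t ∈ Icc (0 : ℝ) 1, CoordTimelike τ x₀ (c t) (c' t)) :
    TimelikeSegment τ ((extChartAt (𝓡 4) x₀).symm (c 0)) ((extChartAt (𝓡 4) x₀).symm (c 1)) := by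
  have hud : UniqueDiffOn ℝ (Icc (0 : ℝ) 1) := uniqueDiffOn_Icc one_pos
  have hcd : ContDiffOn ℝ 1 c (Icc 0 1) := by
    rw [contDiffOn_one_iff_derivWithin hud]
    exact ⟨fun t ht ↦ (hc t ht).differentiableWithinAt,
      hc'.congr fun t ht ↦ (hc t ht).derivWithin (hud t ht)⟩
  have hγ : ContMDiffOn 𝓘(ℝ, ℝ) (𝓡 4) 1 (fun t ↦ (extChartAt (𝓡 4) x₀).symm (c t)) (Icc 0 1) :=
    (contMDiffOn_extChartAt_symm x₀).comp hcd.contMDiffOn hU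
  refine ⟨fun t ↦ (extChartAt (𝓡 4) x₀).symm (c t), hγ, rfl, rfl, fun t ht ↦ ?_⟩
  exact (isFutureTimelike_mfderivWithin_iff τ (hud t ht) (hγ.mdifferentiableOn one_ne_zero t ht)
    ((extChartAt (𝓡 4) x₀).map_target (hU t ht)) ht (hc t ht)
    fun u hu ↦ (extChartAt (𝓡 4) x₀).right_inv (hU u hu)).2 (h t ht)

lemma CoordTimelike.smul {x₀ : M} {y v : EuclideanSpace ℝ (Fin 4)} (h : CoordTimelike τ x₀ y v)
    {a : ℝ} (ha : 0 < a) : CoordTimelike τ x₀ y (a • v) := by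
  constructor
  · simpa [ha, mul_neg_iff, ha.not_gt] using h.1
  · simpa [ha, mul_neg_iff, ha.not_gt] using h.2

lemma IsFutureTimelike.smul {x : M} {v : TangentSpace (𝓡 4) x} (h : IsFutureTimelike τ v)
    {a : ℝ} (ha : 0 < a) : IsFutureTimelike τ (a • v) := by
  constructor
  · rw [map_smul, map_smul]
    exact mul_neg_of_pos_of_neg ha (mul_neg_of_pos_of_neg ha h.1)
  · rw [map_smul]
    exact mul_neg_of_pos_of_neg ha h.2

lemma hasDerivWithinAt_affine (a b t : ℝ) (s : Set ℝ) :
    HasDerivWithinAt (fun t ↦ a + (b - a) * t) (b - a) s t := by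
  simpa using (((hasDerivAt_id t).const_mul (b - a)).const_add a).hasDerivWithinAt

lemma mapsTo_affine_Icc {a b : ℝ} (hab : a ≤ b) :
    MapsTo (fun t ↦ a + (b - a) * t) (Icc 0 1) (Icc a b) := by
  rintro t ⟨h0, h1⟩
  constructor <;> nlinarith

/-- A `C^1` curve in a chart with future directed timelike velocity gives a timelike segment. -/
lemma timelikeSegment_of_coordTimelike {x₀ : M} {a b : ℝ} (hab : a < b)
    {c c' : ℝ → EuclideanSpace ℝ (Fin 4)}
    (hc : ∀ t ∈ Icc a b, HasDerivWithinAt c (c' t) (Icc a b) t)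
    (hc' : ContinuousOn c' (Icc a b))
    (hU : ∀ t ∈ Icc a b, c t ∈ (extChartAt (𝓡 4) x₀).target)
    (h : ∀ t ∈ Icc a b, CoordTimelike τ x₀ (c t) (c' t)) :
    TimelikeSegment τ ((extChartAt (𝓡 4) x₀).symm (c a)) ((extChartAt (𝓡 4) x₀).symm (c b)) := by
  have hm := mapsTo_affine_Icc hab.le
  have := timelikeSegment_of_coordTimelike_unitInterval τ (x₀ := x₀)
    (c := fun t ↦ c (a + (b - a) * t)) (c' := fun t ↦ (b - a) • c' (a + (b - a) * t))
    (fun t ht ↦ (hc _ (hm ht)).scomp t (hasDerivWithinAt_affine a b t _) hm)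
    ((hc'.comp (by fun_prop) hm).const_smul (b - a)) (fun t ht ↦ hU _ (hm ht))
    (fun t ht ↦ (h _ (hm ht)).smul τ (sub_pos.2 hab))
  simpa using this

/-- A subarc of a timelike curve is timelike. -/
lemma timelikeSegment_of_subinterval {γ : ℝ → M} {a b : ℝ}
    (hγ : ContMDiffOn 𝓘(ℝ, ℝ) (𝓡 4) 1 γ (Icc 0 1))
    (h : ∀ t ∈ Icc (0 : ℝ) 1,
      IsFutureTimelike τ (mfderivWithin 𝓘(ℝ, ℝ) (𝓡 4) γ (Icc 0 1) t (1 : ℝ)))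
    (ha : 0 ≤ a) (hab : a < b) (hb : b ≤ 1) : TimelikeSegment τ (γ a) (γ b) := by
  have hm : MapsTo (fun t ↦ a + (b - a) * t) (Icc 0 1) (Icc 0 1) :=
    (mapsTo_affine_Icc hab.le).mono_right (Icc_subset_Icc ha hb)
  have hud : UniqueDiffOn ℝ (Icc (0 : ℝ) 1) := uniqueDiffOn_Icc one_pos
  have hφ : ContMDiff 𝓘(ℝ, ℝ) 𝓘(ℝ, ℝ) 1 (fun t : ℝ ↦ a + (b - a) * t) :=
    ContDiff.contMDiff (by fun_prop)
  refine ⟨fun t ↦ γ (a + (b - a) * t), hγ.comp hφ.contMDiffOn hm, by simp, by simp,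
    fun t ht ↦ ?_⟩
  have h1 := mfderivWithin_comp (I'' := 𝓡 4) t (hγ.mdifferentiableOn one_ne_zero _ (hm ht))
    (hφ.contMDiffOn.mdifferentiableOn one_ne_zero t ht) hm (hud t ht).uniqueMDiffWithinAt
  have h2 : mfderivWithin 𝓘(ℝ, ℝ) 𝓘(ℝ, ℝ) (fun t : ℝ ↦ a + (b - a) * t) (Icc 0 1) t (1 : ℝ)
      = (b - a) • (1 : ℝ) := by
    rw [mfderivWithin_eq_fderivWithin, smul_eq_mul, mul_one]
    exact (hasDerivWithinAt_affine a b t _).derivWithin (hud t ht)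
  have h3 : mfderivWithin 𝓘(ℝ, ℝ) (𝓡 4) (fun t ↦ γ (a + (b - a) * t)) (Icc 0 1) t (1 : ℝ) =
      (b - a) • mfderivWithin 𝓘(ℝ, ℝ) (𝓡 4) γ (Icc 0 1) (a + (b - a) * t) (1 : ℝ) := by
    refine (congrArg (fun L ↦ L (1 : ℝ)) h1).trans ?_
    refine (congrArg (mfderivWithin 𝓘(ℝ, ℝ) (𝓡 4) γ (Icc 0 1) (a + (b - a) * t)) h2).trans ?_
    exact map_smul _ _ _
  rw [h3]
  exact (h _ (hm ht)).smul τ (sub_pos.2 hab)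

end ChartCurves

/-! ### Openness of the chronology relation -/

section Perturbation

variable {M : Type*} [TopologicalSpace M] [ChartedSpace (EuclideanSpace ℝ (Fin 4)) M]

lemma tendsto_extChartAt_sub (p : M) :
    Tendsto (fun p' ↦ extChartAt (𝓡 4) p p' - extChartAt (𝓡 4) p p) (𝓝 p) (𝓝 0) := by
  have := (continuousAt_extChartAt (I := 𝓡 4) p).tendsto.sub_const (extChartAt (𝓡 4) p p)
  rwa [sub_self] at this

lemma exists_pos_forall_mem_source {γ : ℝ → M} (hγ : ContinuousOn γ (Icc 0 1)) {t₀ : ℝ}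
    (ht₀ : t₀ ∈ Icc (0 : ℝ) 1) :
    ∃ δ > 0, ∀ t ∈ Icc (0 : ℝ) 1, |t - t₀| ≤ δ → γ t ∈ (extChartAt (𝓡 4) (γ t₀)).source := by
  have h := hγ t₀ ht₀ (extChartAt_source_mem_nhds (I := 𝓡 4) (γ t₀))
  obtain ⟨ε, hε, h⟩ := Metric.mem_nhdsWithin_iff.1 (mem_map.1 h)
  exact ⟨ε / 2, half_pos hε, fun t ht htt ↦
    h ⟨by rw [Metric.mem_ball, Real.dist_eq]; linarith, ht⟩⟩

variable [IsManifold (𝓡 4) ∞ M] {g : LorentzianMetric M} (τ : TimeOrientation g)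

/-- The coordinate expression of a subarc of a `C^1` curve is `C^1`, and the subarc has the same
velocity as the curve, one-sided derivatives at its end points included. -/
lemma coord_subarc {γ : ℝ → M} {a b : ℝ} {x₀ : M}
    (hγ : ContMDiffOn 𝓘(ℝ, ℝ) (𝓡 4) 1 γ (Icc 0 1)) (ha : 0 ≤ a) (hab : a < b) (hb : b ≤ 1)
    (hx : ∀ t ∈ Icc a b, γ t ∈ (extChartAt (𝓡 4) x₀).source) :
    (∀ t ∈ Icc a b, HasDerivWithinAt (fun t ↦ extChartAt (𝓡 4) x₀ (γ t))
      (derivWithin (fun t ↦ extChartAt (𝓡 4) x₀ (γ t)) (Icc a b) t) (Icc a b) t) ∧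
    ContinuousOn (derivWithin (fun t ↦ extChartAt (𝓡 4) x₀ (γ t)) (Icc a b)) (Icc a b) ∧
    ∀ t ∈ Icc a b, mfderivWithin 𝓘(ℝ, ℝ) (𝓡 4) γ (Icc 0 1) t =
      mfderivWithin 𝓘(ℝ, ℝ) (𝓡 4) γ (Icc a b) t := by
  have hsub : Icc a b ⊆ Icc 0 1 := Icc_subset_Icc ha hb
  have hud : UniqueDiffOn ℝ (Icc a b) := uniqueDiffOn_Icc hab
  have hcd : ContDiffOn ℝ 1 (fun t ↦ extChartAt (𝓡 4) x₀ (γ t)) (Icc a b) := by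
    rw [← contMDiffOn_iff_contDiffOn]
    refine (contMDiffOn_extChartAt (x := x₀)).comp (hγ.mono hsub) fun t ht ↦ ?_
    simpa only [extChartAt_source, mem_preimage] using hx t ht
  refine ⟨fun t ht ↦ (hcd.differentiableOn one_ne_zero t ht).hasDerivWithinAt,
    hcd.continuousOn_derivWithin hud le_rfl, fun t ht ↦ ?_⟩
  exact (mfderivWithin_subset hsub (hud t ht).uniqueMDiffWithinAt
    (hγ.mdifferentiableOn one_ne_zero t (hsub ht))).symm

/-- A timelike subarc lying in one chart remains timelike when `(k + m * t) • w` is added to its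
coordinate expression, for all sufficiently small vectors `w`. -/
lemma eventually_timelikeSegment {γ : ℝ → M} {a b : ℝ} {x₀ : M}
    (hγ : ContMDiffOn 𝓘(ℝ, ℝ) (𝓡 4) 1 γ (Icc 0 1))
    (h : ∀ t ∈ Icc (0 : ℝ) 1,
      IsFutureTimelike τ (mfderivWithin 𝓘(ℝ, ℝ) (𝓡 4) γ (Icc 0 1) t (1 : ℝ)))
    (ha : 0 ≤ a) (hab : a < b) (hb : b ≤ 1)
    (hx : ∀ t ∈ Icc a b, γ t ∈ (extChartAt (𝓡 4) x₀).source) (k m : ℝ) :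
    ∀ᶠ w in 𝓝 (0 : EuclideanSpace ℝ (Fin 4)),
      TimelikeSegment τ ((extChartAt (𝓡 4) x₀).symm (extChartAt (𝓡 4) x₀ (γ a) + (k + m * a) • w))
        ((extChartAt (𝓡 4) x₀).symm (extChartAt (𝓡 4) x₀ (γ b) + (k + m * b) • w)) := by
  obtain ⟨hc, hc', hm⟩ := coord_subarc hγ ha hab hb hx
  have hsub : Icc a b ⊆ Icc 0 1 := Icc_subset_Icc ha hb
  have hud : UniqueDiffOn ℝ (Icc a b) := uniqueDiffOn_Icc hab
  have hU : ∀ t ∈ Icc a b, extChartAt (𝓡 4) x₀ (γ t) ∈ (extChartAt (𝓡 4) x₀).target :=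
    fun t ht ↦ (extChartAt (𝓡 4) x₀).map_source (hx t ht)
  have hct : ∀ t ∈ Icc a b, CoordTimelike τ x₀ (extChartAt (𝓡 4) x₀ (γ t))
      (derivWithin (fun t ↦ extChartAt (𝓡 4) x₀ (γ t)) (Icc a b) t) := fun t ht ↦
    (isFutureTimelike_mfderivWithin_iff τ (hud t ht)
      ((hγ.mono hsub).mdifferentiableOn one_ne_zero t ht) (hx t ht) ht (hc t ht)
      fun _ _ ↦ rfl).1 (hm t ht ▸ h t (hsub ht))
  filter_upwards [eventually_coordTimelike_add_smul τ (f := fun t ↦ k + m * t) (f' := fun _ ↦ m)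
    (fun t ht ↦ (hc t ht).continuousWithinAt) hc' (by fun_prop) (by fun_prop) hU hct] with w hw
  refine timelikeSegment_of_coordTimelike τ hab
    (c := fun t ↦ extChartAt (𝓡 4) x₀ (γ t) + (k + m * t) • w)
    (fun t ht ↦ (hc t ht).add ?_) (hc'.add continuousOn_const) (fun t ht ↦ (hw t ht).1)
    (fun t ht ↦ (hw t ht).2)
  have : HasDerivWithinAt (fun t ↦ k + m * t) m (Icc a b) t := by
    simpa using hasDerivWithinAt_affine k (k + m) t (Icc a b)
  exact this.smul_const w

/-- The initial point of a timelike segment can be moved: near it the curve is perturbed in a chart,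
with a perturbation fading out linearly. -/
lemma TimelikeSegment.eventually_chron_left {p q : M} (h : TimelikeSegment τ p q) :
    ∀ᶠ p' in 𝓝 p, Chron τ p' q := by
  obtain ⟨γ, hγ, rfl, rfl, h⟩ := h
  obtain ⟨δ, hδ, hsrc⟩ := exists_pos_forall_mem_source hγ.continuousOn
    (left_mem_Icc.2 zero_le_one)
  obtain ⟨b, hb0, hb⟩ := exists_between (lt_min hδ one_pos)
  have hb1 : b < 1 := hb.trans_le (min_le_right _ _)
  have hbδ : b < δ := hb.trans_le (min_le_left _ _)
  have hx : ∀ t ∈ Icc 0 b, γ t ∈ (extChartAt (𝓡 4) (γ 0)).source := fun t ht ↦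
    hsrc t ⟨ht.1, ht.2.trans hb1.le⟩ (by rw [sub_zero, abs_of_nonneg ht.1]; linarith [ht.2])
  -- The cutoff `t ↦ 1 - t / b` equals `1` at the initial point and vanishes at `b`.
  have key := eventually_timelikeSegment τ hγ h le_rfl hb0 hb1.le hx 1 (-b⁻¹)
  filter_upwards [(tendsto_extChartAt_sub (γ 0)).eventually key,
    extChartAt_source_mem_nhds (I := 𝓡 4) (γ 0)] with p' hp' hs
  have h0 : (1 + -b⁻¹ * b : ℝ) = 0 := by field_simp; ring
  rw [h0, zero_smul, add_zero, mul_zero, add_zero, one_smul, add_sub_cancel,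
    (extChartAt (𝓡 4) (γ 0)).left_inv hs,
    (extChartAt (𝓡 4) (γ 0)).left_inv (hx b (right_mem_Icc.2 hb0.le))] at hp'
  exact .tail (.single hp') (timelikeSegment_of_subinterval τ hγ h hb0.le hb1 le_rfl)

lemma TimelikeSegment.eventually_chron_right {p q : M} (h : TimelikeSegment τ p q) :
    ∀ᶠ q' in 𝓝 q, Chron τ p q' := by
  obtain ⟨γ, hγ, rfl, rfl, h⟩ := h
  obtain ⟨δ, hδ, hsrc⟩ := exists_pos_forall_mem_source hγ.continuousOn
    (right_mem_Icc.2 zero_le_one)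
  obtain ⟨d, hd0, hd⟩ := exists_between (lt_min hδ one_pos)
  have hd1 : d < 1 := hd.trans_le (min_le_right _ _)
  have hdδ : d < δ := hd.trans_le (min_le_left _ _)
  have ha0 : 0 < 1 - d := by linarith
  have ha1 : 1 - d < 1 := by linarith
  have hx : ∀ t ∈ Icc (1 - d) 1, γ t ∈ (extChartAt (𝓡 4) (γ 1)).source := fun t ht ↦
    hsrc t ⟨by linarith [ht.1], ht.2⟩ (by rw [abs_le]; constructor <;> linarith [ht.1, ht.2])
  -- The cutoff `t ↦ (t - (1 - d)) / d` vanishes at `1 - d` and equals `1` at the end point.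
  have key := eventually_timelikeSegment τ hγ h ha0.le ha1 le_rfl hx (1 - d⁻¹) d⁻¹
  filter_upwards [(tendsto_extChartAt_sub (γ 1)).eventually key,
    extChartAt_source_mem_nhds (I := 𝓡 4) (γ 1)] with q' hq' hs
  have h0 : (1 - d⁻¹ + d⁻¹ * (1 - d) : ℝ) = 0 := by field_simp; ring
  have h1 : (1 - d⁻¹ + d⁻¹ * 1 : ℝ) = 1 := by ring
  rw [h0, h1, zero_smul, add_zero, one_smul, add_sub_cancel,
    (extChartAt (𝓡 4) (γ 1)).left_inv hs,
    (extChartAt (𝓡 4) (γ 1)).left_inv (hx _ (left_mem_Icc.2 ha1.le))] at hq'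
  exact .tail (.single (timelikeSegment_of_subinterval τ hγ h le_rfl ha0 ha1.le)) hq'

lemma isOpen_setOf_chron_left (q : M) : IsOpen {p | Chron τ p q} := by
  rw [isOpen_iff_mem_nhds]
  intro p hp
  obtain ⟨b, hpb, hbq⟩ := Relation.TransGen.head'_iff.1 hp
  filter_upwards [hpb.eventually_chron_left τ] with p' hp' using hp'.trans_left hbq

lemma isOpen_setOf_chron_right (p : M) : IsOpen {q | Chron τ p q} := by
  rw [isOpen_iff_mem_nhds]
  intro q hq
  obtain ⟨b, hpb, hbq⟩ := Relation.TransGen.tail'_iff.1 hq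
  filter_upwards [hbq.eventually_chron_right τ] with q' hq' using hq'.trans_right hpb

end Perturbation

/-! ### Causal curves and closures of pasts -/

section Causal

variable {M : Type*} [TopologicalSpace M] [ChartedSpace (EuclideanSpace ℝ (Fin 4)) M]
  [IsManifold (𝓡 4) ∞ M] {g : LorentzianMetric M} (τ : TimeOrientation g)

/-- Adding `ε • T` to a causal vector `v` with `B v T < 0` gives a vector which is timelike for every
form `B'` that differs from `B` by at most a small multiple of `ε`. -/
lemma apply_add_smul_neg {E : Type*} [NormedAddCommGroup E] [NormedSpace ℝ E]
    {B B' : E →L[ℝ] E →L[ℝ] ℝ} (hB : ∀ v w, B v w = B w v) {v T : E} {ε η : ℝ} (hε : 0 < ε)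
    (hv : B v v ≤ 0) (hBB' : ‖B' - B‖ ≤ ε * η)
    (h : 2 * B v T + ε * B T T + η * ‖v + ε • T‖ ^ 2 < 0) :
    B' (v + ε • T) (v + ε • T) < 0 := by
  have h1 : (B' - B) (v + ε • T) (v + ε • T) ≤ ε * η * ‖v + ε • T‖ ^ 2 := by
    refine (le_abs_self _).trans (((B' - B).le_opNorm₂ _ _).trans ?_)
    rw [mul_assoc, ← pow_two]
    gcongr
  have h2 : B (v + ε • T) (v + ε • T) = B v v + ε * (2 * B v T + ε * B T T) := by
    simp only [map_add, map_smul, add_apply, smul_apply, smul_eq_mul]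
    rw [hB T v]
    ring
  have h3 : B' (v + ε • T) (v + ε • T) =
      (B' - B) (v + ε • T) (v + ε • T) + B (v + ε • T) (v + ε • T) := by
    simp
  have h4 := mul_neg_of_pos_of_neg hε h
  rw [h3, h2]
  linarith

lemma tendsto_clm_apply₂ {ι E : Type*} [NormedAddCommGroup E] [NormedSpace ℝ E] {l : Filter ι}
    {B : ι → E →L[ℝ] E →L[ℝ] ℝ} {v w : ι → E} {B₀ : E →L[ℝ] E →L[ℝ] ℝ} {v₀ w₀ : E}
    (hB : Tendsto B l (𝓝 B₀)) (hv : Tendsto v l (𝓝 v₀)) (hw : Tendsto w l (𝓝 w₀)) :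
    Tendsto (fun i ↦ B i (v i) (w i)) l (𝓝 (B₀ v₀ w₀)) := by
  have hcont : Continuous fun p : (E →L[ℝ] E →L[ℝ] ℝ) × E × E ↦ p.1 p.2.1 p.2.2 := by fun_prop
  exact (hcont.tendsto (B₀, v₀, w₀)).comp (hB.prodMk_nhds (hv.prodMk_nhds hw))

/-- Let `c` be a curve in a chart with causal velocity `c'`. Tilting it by the time orientation `T`
at its end point `c t₀`, that is, passing to `t ↦ c t - ε (t₀ - t) T`, makes it timelike near `t₀`,
on an interval that does not depend on the small parameter `ε > 0`: the tilt improves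
the norm of the velocity by an amount of order `ε`, whereas the change of base point costs an amount
of order `ε (t₀ - t)`. -/
lemma eventually_coordTimelike_tilt {x₀ : M} {a t₀ : ℝ} (hat : a < t₀)
    {c c' : ℝ → EuclideanSpace ℝ (Fin 4)}
    (hc : ContinuousOn c (Icc a t₀)) (hc' : ContinuousOn c' (Icc a t₀))
    (hU : ∀ t ∈ Icc a t₀, c t ∈ (extChartAt (𝓡 4) x₀).target)
    (h : ∀ t ∈ Icc a t₀, coordMetric g x₀ ((extChartAt (𝓡 4) x₀).symm (c t)) (c' t) (c' t) ≤ 0 ∧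
      coordMetric g x₀ ((extChartAt (𝓡 4) x₀).symm (c t))
        (coordField τ x₀ ((extChartAt (𝓡 4) x₀).symm (c t))) (c' t) < 0)
    {T : EuclideanSpace ℝ (Fin 4)} (hT : coordField τ x₀ ((extChartAt (𝓡 4) x₀).symm (c t₀)) = T) :
    ∀ᶠ p : ℝ × ℝ in 𝓝[Icc a t₀] t₀ ×ˢ 𝓝[>] (0 : ℝ),
      c p.1 - (p.2 * (t₀ - p.1)) • T ∈ (extChartAt (𝓡 4) x₀).target ∧
        CoordTimelike τ x₀ (c p.1 - (p.2 * (t₀ - p.1)) • T) (c' p.1 + p.2 • T) := by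
  set l := 𝓝[Icc a t₀] t₀ ×ˢ 𝓝[>] (0 : ℝ) with hl
  set G : EuclideanSpace ℝ (Fin 4) → _ :=
    fun y ↦ coordMetric g x₀ ((extChartAt (𝓡 4) x₀).symm y) with hG
  set V : EuclideanSpace ℝ (Fin 4) → _ :=
    fun y ↦ coordField τ x₀ ((extChartAt (𝓡 4) x₀).symm y) with hV
  have ht₀ : t₀ ∈ Icc a t₀ := right_mem_Icc.2 hat.le
  have hUn := (isOpen_extChartAt_target (I := 𝓡 4) x₀).mem_nhds (hU t₀ ht₀)
  have hGc : ContDiffAt ℝ 1 G (c t₀) := (contDiffOn_coordMetric g x₀).contDiffAt hUn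
  have hVc : Tendsto V (𝓝 (c t₀)) (𝓝 T) :=
    hT ▸ ((continuousOn_coordField τ x₀).continuousAt hUn).tendsto
  obtain ⟨K, W, hW, hK⟩ := hGc.exists_lipschitzOnWith
  have l1 : Tendsto (fun p : ℝ × ℝ ↦ p.1) l (𝓝 t₀) := tendsto_fst.mono_right nhdsWithin_le_nhds
  have l2 : Tendsto (fun p : ℝ × ℝ ↦ p.2) l (𝓝 0) := tendsto_snd.mono_right nhdsWithin_le_nhds
  have lpos : ∀ᶠ p : ℝ × ℝ in l, 0 < p.2 := tendsto_snd.eventually self_mem_nhdsWithin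
  have lmem : ∀ᶠ p : ℝ × ℝ in l, p.1 ∈ Icc a t₀ := tendsto_fst.eventually self_mem_nhdsWithin
  have lc : Tendsto (fun p : ℝ × ℝ ↦ c p.1) l (𝓝 (c t₀)) := (hc t₀ ht₀).tendsto.comp tendsto_fst
  have lc' : Tendsto (fun p : ℝ × ℝ ↦ c' p.1) l (𝓝 (c' t₀)) :=
    (hc' t₀ ht₀).tendsto.comp tendsto_fst
  have lz : Tendsto (fun p : ℝ × ℝ ↦ c p.1 - (p.2 * (t₀ - p.1)) • T) l (𝓝 (c t₀)) := by
    simpa using lc.sub ((l2.mul (l1.const_sub t₀)).smul_const T)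
  have lv : Tendsto (fun p : ℝ × ℝ ↦ c' p.1 + p.2 • T) l (𝓝 (c' t₀)) := by
    simpa using lc'.add (l2.smul_const T)
  have lGc : Tendsto (fun p : ℝ × ℝ ↦ G (c p.1)) l (𝓝 (G (c t₀))) :=
    hGc.continuousAt.tendsto.comp lc
  have lGz : Tendsto (fun p : ℝ × ℝ ↦ G (c p.1 - (p.2 * (t₀ - p.1)) • T)) l (𝓝 (G (c t₀))) :=
    hGc.continuousAt.tendsto.comp lz
  have hneg : G (c t₀) T (c' t₀) < 0 := hT ▸ (h t₀ ht₀).2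
  have e1 : ∀ᶠ p : ℝ × ℝ in l,
      G (c p.1 - (p.2 * (t₀ - p.1)) • T) (V (c p.1 - (p.2 * (t₀ - p.1)) • T))
        (c' p.1 + p.2 • T) < 0 :=
    (tendsto_clm_apply₂ lGz (hVc.comp lz) lv).eventually_lt_const hneg
  have e2 : ∀ᶠ p : ℝ × ℝ in l,
      2 * G (c p.1) (c' p.1) T + p.2 * G (c p.1) T T +
        (K * ((t₀ - p.1) * ‖T‖)) * ‖c' p.1 + p.2 • T‖ ^ 2 < 0 := by
    have lim := (((tendsto_clm_apply₂ lGc lc' (tendsto_const_nhds (x := T))).const_mul 2).add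
      (l2.mul (tendsto_clm_apply₂ lGc (tendsto_const_nhds (x := T))
        (tendsto_const_nhds (x := T))))).add
      ((((l1.const_sub t₀).mul_const ‖T‖).const_mul (K : ℝ)).mul (lv.norm.pow 2))
    refine lim.eventually_lt_const ?_
    have : G (c t₀) (c' t₀) T < 0 := by rw [hG, coordMetric_symm]; exact hneg
    simpa using mul_neg_of_pos_of_neg two_pos this
  filter_upwards [lpos, lmem, lc.eventually_mem hW, lz.eventually_mem hW, lz.eventually_mem hUn,
    e1, e2] with p hp hpm hcW hzW hzU h1 h2
  refine ⟨hzU, ?_, h1⟩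
  refine apply_add_smul_neg (coordMetric_symm g x₀ _) hp (h p.1 hpm).1 ?_ h2
  have h3 := hK.norm_sub_le hzW hcW
  refine h3.trans (le_of_eq ?_)
  rw [sub_sub_cancel_left, norm_neg, norm_smul, Real.norm_of_nonneg
    (mul_nonneg hp.le (sub_nonneg.2 hpm.2))]
  ring

/-- Each point of a causal curve other than its initial point is preceded by a point of the curve
that lies in the closure of its chronological past. -/
lemma exists_lt_mem_closure_chronPast {γ : ℝ → M}
    (hγ : ContMDiffOn 𝓘(ℝ, ℝ) (𝓡 4) 1 γ (Icc 0 1))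
    (h : ∀ t ∈ Icc (0 : ℝ) 1,
      IsFutureCausal τ (mfderivWithin 𝓘(ℝ, ℝ) (𝓡 4) γ (Icc 0 1) t (1 : ℝ)))
    {t₀ : ℝ} (ht₀ : t₀ ∈ Ioc (0 : ℝ) 1) :
    ∃ t ∈ Ico 0 t₀, γ t ∈ closure (chronPast τ {γ t₀}) := by
  -- On `[a, t₀]` the curve stays in the chart at `γ t₀`.
  obtain ⟨δ, hδ, hsrc⟩ := exists_pos_forall_mem_source hγ.continuousOn (Ioc_subset_Icc_self ht₀)
  set a := max 0 (t₀ - δ) with ha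
  have ha0 : 0 ≤ a := le_max_left _ _
  have haδ : t₀ - δ ≤ a := le_max_right _ _
  have hat : a < t₀ := max_lt ht₀.1 (by linarith)
  have hsub : Icc a t₀ ⊆ Icc 0 1 := Icc_subset_Icc ha0 ht₀.2
  have hx : ∀ t ∈ Icc a t₀, γ t ∈ (extChartAt (𝓡 4) (γ t₀)).source := fun t ht ↦
    hsrc t (hsub ht) (by rw [abs_le]; constructor <;> linarith [ht.1, ht.2])
  obtain ⟨hc, hc', hm⟩ := coord_subarc hγ ha0 hat ht₀.2 hx
  set c := fun t ↦ extChartAt (𝓡 4) (γ t₀) (γ t) with hcdef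
  have hud : UniqueDiffOn ℝ (Icc a t₀) := uniqueDiffOn_Icc hat
  have hU : ∀ t ∈ Icc a t₀, c t ∈ (extChartAt (𝓡 4) (γ t₀)).target :=
    fun t ht ↦ (extChartAt (𝓡 4) (γ t₀)).map_source (hx t ht)
  have hcausal := fun t (ht : t ∈ Icc a t₀) ↦ IsFutureCausal.coord τ (hud t ht)
    ((hγ.mono hsub).mdifferentiableOn one_ne_zero t ht) (hx t ht) ht (hc t ht)
    (fun _ _ ↦ rfl) (hm t ht ▸ h t (hsub ht))
  have key := eventually_coordTimelike_tilt τ hat (fun t ht ↦ (hc t ht).continuousWithinAt) hc' hU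
    hcausal rfl
  set T := coordField τ (γ t₀) ((extChartAt (𝓡 4) (γ t₀)).symm (c t₀))
  obtain ⟨P, hP, Q, hQ, hPQ⟩ := eventually_prod_iff.1 key
  rw [nhdsWithin_Icc_eq_nhdsLE hat] at hP
  obtain ⟨b₁, hb₁, hbP⟩ := mem_nhdsLE_iff_exists_Icc_subset.1 hP
  -- On `[b, t₀]` the tilted curves are timelike for all small `ε`, with `b` independent of `ε`.
  set b := max a b₁ with hb
  have hab : a ≤ b := le_max_left _ _
  have hbt : b < t₀ := max_lt hat hb₁
  have hsubb : Icc b t₀ ⊆ Icc a t₀ := Icc_subset_Icc_left hab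
  refine ⟨b, ⟨ha0.trans hab, hbt⟩, ?_⟩
  have hbm : b ∈ Icc a t₀ := ⟨hab, hbt.le⟩
  have hlim : Tendsto (fun ε : ℝ ↦ (extChartAt (𝓡 4) (γ t₀)).symm (c b - (ε * (t₀ - b)) • T))
      (𝓝[>] 0) (𝓝 (γ b)) := by
    have h1 : Tendsto (fun ε : ℝ ↦ c b - (ε * (t₀ - b)) • T) (𝓝 0) (𝓝 (c b)) := by
      have : Continuous fun ε : ℝ ↦ c b - (ε * (t₀ - b)) • T := by fun_prop
      simpa using this.tendsto 0
    have h2 := (continuousAt_extChartAt_symm'' (hU b hbm)).tendsto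
    rw [(extChartAt (𝓡 4) (γ t₀)).left_inv (hx b hbm)] at h2
    exact (h2.comp h1).mono_left nhdsWithin_le_nhds
  refine mem_closure_of_tendsto hlim ?_
  filter_upwards [hQ] with ε hε
  have hgood := fun t (ht : t ∈ Icc b t₀) ↦ hPQ (hbP ⟨(le_max_right _ _).trans ht.1, ht.2⟩) hε
  have hseg := timelikeSegment_of_coordTimelike τ hbt (c := fun t ↦ c t - (ε * (t₀ - t)) • T)
    (c' := fun t ↦ derivWithin c (Icc a t₀) t + ε • T) (fun t ht ↦ ?_)
    ((hc'.mono hsubb).add continuousOn_const) (fun t ht ↦ (hgood t ht).1)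
    (fun t ht ↦ (hgood t ht).2)
  · rw [sub_self, mul_zero, zero_smul, sub_zero,
      (extChartAt (𝓡 4) (γ t₀)).left_inv (hx t₀ (right_mem_Icc.2 hat.le))] at hseg
    exact ⟨γ t₀, rfl, .single hseg⟩
  · have h1 : HasDerivWithinAt (fun t ↦ ε * (t₀ - t)) (-ε) (Icc b t₀) t := by
      simpa using (((hasDerivAt_id t).const_sub t₀).const_mul ε).hasDerivWithinAt
    have h2 := ((hc t (hsubb ht)).mono hsubb).sub (h1.smul_const T)
    rwa [neg_smul, sub_neg_eq_add] at h2

/-- A closed-set version of the push-up property `p ≤ q ≪ r → p ≪ r`: the set of parameters at which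
a causal curve lies in `closure A` is closed and has no positive minimum. -/
lemma mem_closure_of_causalSegment {A : Set M} (hA : chronPast τ (closure A) ⊆ A) {p q : M}
    (hpq : CausalSegment τ p q) (hq : q ∈ closure A) : p ∈ closure A := by
  obtain ⟨γ, hγ, rfl, rfl, h⟩ := hpq
  have hcl : IsClosed (γ ⁻¹' closure A ∩ Icc 0 1) := by
    rw [inter_comm]
    exact hγ.continuousOn.preimage_isClosed_of_isClosed isClosed_Icc isClosed_closure
  refine hcl.mem_of_ge_of_forall_exists_lt hq zero_le_one fun t₀ ⟨ht₀, ht₀'⟩ ↦ ?_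
  obtain ⟨t, ht, htc⟩ := exists_lt_mem_closure_chronPast τ hγ h ht₀'
  refine ⟨t, closure_mono ?_ htc, ht⟩
  rintro x ⟨_, rfl, hx⟩
  exact hA ⟨_, ht₀, hx⟩

end Causal

end Spacetime

theorem mainTheorem3 {M : Type*} [TopologicalSpace M] [T2Space M] [SecondCountableTopology M]
    [ChartedSpace (EuclideanSpace ℝ (Fin 4)) M] [IsManifold (𝓡 4) ∞ M]
    (g : Spacetime.LorentzianMetric M) (τ : Spacetime.TimeOrientation g)
    (r : M) (hr : r ∈ Spacetime.chronologyViolatingSet τ)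
    (hM : Spacetime.chronFuture τ (Spacetime.chronologyClass τ r) = univ) :
    frontier (Spacetime.chronologyClass τ r) =
        Spacetime.futureBoundary τ (Spacetime.chronologyClass τ r) ∧
      Spacetime.causalPast τ (closure (Spacetime.chronologyClass τ r)) =
        closure (Spacetime.chronologyClass τ r) ∧
      Spacetime.chronPast τ (closure (Spacetime.chronologyClass τ r)) =
        Spacetime.chronologyClass τ r := by
  have hall : ∀ q, Spacetime.Chron τ r q := fun q ↦ by
    obtain ⟨p, hp, hpq⟩ : q ∈ Spacetime.chronFuture τ (Spacetime.chronologyClass τ r) :=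
      hM ▸ mem_univ q
    exact hp.1.trans hpq
  have hclass : Spacetime.chronologyClass τ r = {q | Spacetime.Chron τ q r} :=
    Set.ext fun q ↦ ⟨fun h ↦ h.2, fun h ↦ ⟨hall q, h⟩⟩
  have hrr : r ∈ Spacetime.chronologyClass τ r := ⟨hr, hr⟩
  have hopen : IsOpen (Spacetime.chronologyClass τ r) :=
    hclass ▸ Spacetime.isOpen_setOf_chron_left τ r
  have hsub : Spacetime.chronPast τ (closure (Spacetime.chronologyClass τ r)) ⊆
      Spacetime.chronologyClass τ r := by
    rintro p ⟨q, hq, hpq⟩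
    obtain ⟨q', hpq', hq'⟩ :=
      mem_closure_iff.1 hq _ (Spacetime.isOpen_setOf_chron_right τ p) hpq
    exact ⟨hall p, hpq'.trans hq'.2⟩
  have hpast : Spacetime.chronPast τ (Spacetime.chronologyClass τ r) =
      Spacetime.chronologyClass τ r :=
    Subset.antisymm (fun p ⟨q, hq, hpq⟩ ↦ hsub ⟨q, subset_closure hq, hpq⟩)
      fun p hp ↦ ⟨r, hrr, hp.2⟩
  refine ⟨?_, Subset.antisymm ?_ fun p hp ↦ ⟨p, hp, .refl⟩,
    hsub.antisymm fun p hp ↦ ⟨r, subset_closure hrr, hp.2⟩⟩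
  · rw [Spacetime.futureBoundary, hpast, hopen.frontier_eq]
  · rintro p ⟨q, hq, hpq⟩
    induction hpq using Relation.ReflTransGen.head_induction_on with
    | refl => exact hq
    | head hab _ ih => exact Spacetime.mem_closure_of_causalSegment τ hsub hab ih
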